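/- A gyrogroup is a set $G$ with a binary operation $\oplus$ such that: (1) there is a unique $1\in G$ with $1\oplus g=g=g\oplus 1$ for all $g\in G$; (2) each $g\in G$ has a unique inverse $\ominus g$, i.e. $\ominus g\oplus g=1=g\oplus(\ominus g)$; (3) for all $g,h\in G$ there is an automorphism $\mathrm{gyr}[g,h]$ of $(G,\oplus)$ with $g\oplus(h\oplus f)=(g\oplus h)\oplus \mathrm{gyr}[g,h](f)$ for all $f\in G$; (4) $\mathrm{gyr}[g,h]=\mathrm{gyr}[g\oplus h,h]$ for all $g,h\in G$. A subgyrogroup is a nonempty subset closed under $\oplus$ and $\ominus$. A strongly topological gyrogroup is a gyrogroup with a topology for which $\oplus:G\times G\to G$ and $\ominus:G\to G$ are continuous and which has a neighborhood base $\mathcal U$ at $1$ with $\mathrm{gyr}[x,y](U)=U$ for all $x,y\in G$ and $U\in\mathcal U$. It is a strongly topologically orderable gyrogroup if, moreover, its topology is the order topology of some total order on $G$. A suitable set for $G$ is a subset $S\subseteq G$ that is discrete in its subspace topology, such that $S\cup\{1\}$ is closed in $G$ and the subgyrogroup generated by $S$ (the smallest subgyrogroup containing $S$) is dense in $G$. Corollary.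 Every strongly topologically orderable gyrogroup that is not totally disconnected admits a suitable set. -/

import Mathlib

open Topology

/-- A gyrogroup. The operation `⊕` is written `+`, its identity `0`, the inverse `⊖ g` is `-g`,
and `gyr g h` is the automorphism `gyr[g, h]` of `(G, ⊕)`. The operation is in general neither
associative nor commutative. Uniqueness of the identity, of inverses and of the gyrations follows
from the axioms (see the lemmas below). -/
class Gyrogroup (G : Type*) extends Add G, Zero G, Neg G where
  protected zero_add : ∀ g : G, 0 + g = g
  protected add_zero : ∀ g : G, g + 0 = g
  protected neg_add_self : ∀ g : G, -g + g = 0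
  protected add_neg_self : ∀ g : G, g + -g = 0
  /-- The gyration `gyr[g, h]`, a bijection of `G` onto itself that preserves the operation. -/
  gyr : G → G → (G ≃+ G)
  /-- Left gyroassociative law. -/
  add_gyr : ∀ g h f : G, g + (h + f) = (g + h) + gyr g h f
  /-- Left loop property. -/
  gyr_loop : ∀ g h : G, gyr g h = gyr (g + h) h

namespace Gyrogroup

variable {G : Type*} [Gyrogroup G]

theorem identity_unique (e : G) (he : ∀ g : G, e + g = g) : e = 0 := by
  rw [← Gyrogroup.add_zero e, he]

theorem add_left_cancel_gyro (g a b : G) (hab : g + a = g + b) : a = b := by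
  have key : ∀ f : G, -g + (g + f) = gyr (-g) g f := fun f => by
    rw [add_gyr, Gyrogroup.neg_add_self, Gyrogroup.zero_add]
  apply (gyr (-g) g).injective
  rw [← key, ← key, hab]

theorem neg_unique (g x : G) (hx : g + x = 0) : x = -g :=
  add_left_cancel_gyro g x (-g) (hx.trans (Gyrogroup.add_neg_self g).symm)

theorem gyr_unique (g h : G) (φ : G ≃+ G) (hφ : ∀ f : G, g + (h + f) = (g + h) + φ f) :
    φ = gyr g h := by
  ext f
  exact add_left_cancel_gyro (g + h) _ _ ((hφ f).symm.trans (add_gyr g h f))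

/-- A subgyrogroup, as a set: nonempty and closed under inversion and the operation. -/
def IsSubgyrogroup (H : Set G) : Prop :=
  H.Nonempty ∧ (∀ a ∈ H, -a ∈ H) ∧ ∀ a ∈ H, ∀ b ∈ H, a + b ∈ H

/-- The subgyrogroup generated by `S`: the intersection of all subgyrogroups containing `S`. -/
def generated (S : Set G) : Set G :=
  ⋂₀ {H : Set G | IsSubgyrogroup H ∧ S ⊆ H}

end Gyrogroup

/-- A topological gyrogroup: the operation is jointly continuous and inversion is continuous. -/
class TopologicalGyrogroup (G : Type*) [TopologicalSpace G] [Gyrogroup G] : Prop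
    extends ContinuousAdd G, ContinuousNeg G

/-- A strongly topological gyrogroup: a topological gyrogroup with a neighbourhood base at the
identity all of whose members are mapped onto themselves by every gyration. -/
class StronglyTopologicalGyrogroup (G : Type*) [TopologicalSpace G] [Gyrogroup G] : Prop
    extends TopologicalGyrogroup G where
  exists_invariant_basis : ∃ 𝓤 : Set (Set G), (𝓝 (0 : G)).HasBasis (fun U => U ∈ 𝓤) id ∧
    ∀ U ∈ 𝓤, ∀ x y : G, Gyrogroup.gyr x y '' U = U

/-- The topology of `G` is the order topology of some total order on `G`; no compatibility of the
order with any algebraic structure is required. -/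
def TopologicallyOrderable (G : Type*) [TopologicalSpace G] : Prop :=
  ∃ _ : LinearOrder G, OrderTopology G

/-- `S` is a suitable set for `G`: it is discrete in its subspace topology, adding the identity
makes it closed in `G`, and it generates a dense subgyrogroup. -/
def IsSuitableSet {G : Type*} [TopologicalSpace G] [Gyrogroup G] (S : Set G) : Prop :=
  IsDiscrete S ∧ IsClosed (S ∪ {0}) ∧ Dense (Gyrogroup.generated S)

/-! A component with two points contains a nonempty open interval, so by left translation every
component is open. The component `C` of the identity is then a connected ordered gyrogroup, and
connectedness forces the order to respect the operation: each required property holds on a nonempty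
clopen set. Hence `C` is Archimedean, and repeated "halving" gives a sequence tending to the
identity that lies in no proper closed subgyrogroup of `C`
(`exists_seq_tendsto_zero_generating_dense`). This sequence, with one point from each other
component, is suitable: it can accumulate only at the identity, and left translates of `C` by the
chosen points cover the rest (`exists_isSuitableSet_of_isOpen_connectedComponent`). -/

open Filter Set

namespace Gyrogroup

/-! ### Cancellation laws and subgyrogroups. -/

section Algebra

variable {G : Type*} [Gyrogroup G]

theorem gyr_zero_left (g f : G) : gyr 0 g f = f := by
  apply add_left_cancel_gyro g
  have h := add_gyr 0 g f
  rwa [Gyrogroup.zero_add, Gyrogroup.zero_add, eq_comm] at h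

theorem neg_add_cancel_left_gyro (g f : G) : -g + (g + f) = f := by
  rw [add_gyr, gyr_loop, Gyrogroup.neg_add_self, Gyrogroup.zero_add, gyr_zero_left]

theorem neg_neg_gyro (g : G) : - -g = g :=
  (neg_unique (-g) g (Gyrogroup.neg_add_self g)).symm

theorem add_neg_cancel_left_gyro (g f : G) : g + (-g + f) = f := by
  simpa only [neg_neg_gyro] using neg_add_cancel_left_gyro (-g) f

/-- By the loop property `gyr x a` depends only on `x + a` and `a`; then associate with `-a`. -/
theorem add_right_cancel_gyro (a x y : G) (h : x + a = y + a) : x = y := by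
  have hg : gyr x a = gyr y a := by rw [gyr_loop x a, h, ← gyr_loop]
  have := add_gyr x a (-a)
  rwa [hg, h, ← add_gyr, Gyrogroup.add_neg_self, Gyrogroup.add_zero, Gyrogroup.add_zero] at this

/-- This formula and the next show that every subgyrogroup is stable under its own gyrations and
their inverses. -/
theorem gyr_eq (a b f : G) : gyr a b f = -(a + b) + (a + (b + f)) := by
  rw [add_gyr a b f, neg_add_cancel_left_gyro]

theorem gyr_symm_eq (a b f : G) : (gyr a b).symm f = -b + (-a + ((a + b) + f)) := by
  have h := add_gyr a b ((gyr a b).symm f)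
  rw [AddEquiv.apply_symm_apply] at h
  rw [← h, neg_add_cancel_left_gyro, neg_add_cancel_left_gyro]

theorem IsSubgyrogroup.zero_mem {H : Set G} (hH : IsSubgyrogroup H) : (0 : G) ∈ H := by
  obtain ⟨⟨a, ha⟩, hneg, hadd⟩ := hH
  exact Gyrogroup.neg_add_self a ▸ hadd _ (hneg a ha) a ha

/-- The operation of a subgyrogroup. -/
abbrev IsSubgyrogroup.toAdd {H : Set G} (hH : IsSubgyrogroup H) : Add H :=
  ⟨fun a b => ⟨a + b, hH.2.2 a a.2 b b.2⟩⟩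

/-- The gyrations of a subgyrogroup, restricted from the ambient gyrogroup. -/
def IsSubgyrogroup.gyrRestrict {H : Set G} (hH : IsSubgyrogroup H) (a b : H) :
    letI := hH.toAdd
    H ≃+ H :=
  letI := hH.toAdd
  { toFun f := ⟨gyr a.1 b.1 f, by
      have hadd := hH.2.2
      rw [gyr_eq]
      exact hadd _ (hH.2.1 _ (hadd _ a.2 _ b.2)) _ (hadd _ a.2 _ (hadd _ b.2 _ f.2))⟩
    invFun f := ⟨(gyr a.1 b.1).symm f, by
      have hadd := hH.2.2
      rw [gyr_symm_eq]
      exact hadd _ (hH.2.1 _ b.2) _ (hadd _ (hH.2.1 _ a.2) _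
        (hadd _ (hadd _ a.2 _ b.2) _ f.2))⟩
    left_inv f := Subtype.ext ((gyr a.1 b.1).symm_apply_apply f.1)
    right_inv f := Subtype.ext ((gyr a.1 b.1).apply_symm_apply f.1)
    map_add' f g := Subtype.ext (map_add (gyr a.1 b.1) f.1 g.1) }

/-- The gyrogroup structure of a subgyrogroup. -/
abbrev IsSubgyrogroup.toGyrogroup {H : Set G} (hH : IsSubgyrogroup H) : Gyrogroup H where
  toAdd := hH.toAdd
  zero := ⟨0, hH.zero_mem⟩
  neg a := ⟨-a, hH.2.1 a a.2⟩
  zero_add a := Subtype.ext (Gyrogroup.zero_add a.1)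
  add_zero a := Subtype.ext (Gyrogroup.add_zero a.1)
  neg_add_self a := Subtype.ext (Gyrogroup.neg_add_self a.1)
  add_neg_self a := Subtype.ext (Gyrogroup.add_neg_self a.1)
  gyr := hH.gyrRestrict
  add_gyr a b f := Subtype.ext (add_gyr a.1 b.1 f.1)
  gyr_loop a b := by
    let := hH.toAdd
    refine AddEquiv.ext fun f => Subtype.ext ?_
    exact congrArg (fun e : G ≃+ G => e f.1) (gyr_loop a.1 b.1)

theorem subset_generated (S : Set G) : S ⊆ generated S :=
  fun _ hx _ hH => hH.2 hx

theorem isSubgyrogroup_generated (S : Set G) : IsSubgyrogroup (generated S) :=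
  ⟨⟨0, fun _ hH => hH.1.zero_mem⟩, fun a ha H hH => hH.1.2.1 a (ha H hH),
    fun a ha b hb H hH => hH.1.2.2 a (ha H hH) b (hb H hH)⟩

end Algebra

/-! ### Connected ordered gyrogroups. -/

section ConnectedOrder

variable {C : Type*} [Gyrogroup C] [TopologicalSpace C] [ContinuousAdd C] [LinearOrder C]
  [OrderTopology C] [PreconnectedSpace C]

/-- By cancellation the strict and weak inequalities define the same set of `x`, which is therefore
clopen; it contains `0`. -/
theorem add_lt_add_left_of_connected {a b : C} (h : a < b) (x : C) : x + a < x + b := by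
  have hU : IsClopen {x : C | x + a < x + b} := by
    refine ⟨?_, isOpen_lt (by fun_prop) (by fun_prop)⟩
    have : {x : C | x + a < x + b} = {x : C | x + a ≤ x + b} := by
      ext x
      exact ⟨le_of_lt, fun hx => hx.lt_of_ne fun e => h.ne (add_left_cancel_gyro x a b e)⟩
    rw [this]
    exact isClosed_le (by fun_prop) (by fun_prop)
  have := hU.eq_univ ⟨0, by simpa [Gyrogroup.zero_add] using h⟩
  exact this.ge (mem_univ x)

theorem add_lt_add_right_of_connected {a b : C} (h : a < b) (x : C) : a + x < b + x := by
  have hU : IsClopen {x : C | a + x < b + x} := by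
    refine ⟨?_, isOpen_lt (by fun_prop) (by fun_prop)⟩
    have : {x : C | a + x < b + x} = {x : C | a + x ≤ b + x} := by
      ext x
      exact ⟨le_of_lt, fun hx => hx.lt_of_ne fun e => h.ne (add_right_cancel_gyro x a b e)⟩
    rw [this]
    exact isClosed_le (by fun_prop) (by fun_prop)
  have := hU.eq_univ ⟨0, by simpa [Gyrogroup.add_zero] using h⟩
  exact this.ge (mem_univ x)

theorem add_le_add_of_connected {a b c d : C} (h : a ≤ b) (h' : c ≤ d) : a + c ≤ b + d := by
  have h1 : a + c ≤ b + c := h.eq_or_lt.elim (fun e => e ▸ le_rfl)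
    fun hl => (add_lt_add_right_of_connected hl c).le
  have h2 : b + c ≤ b + d := h'.eq_or_lt.elim (fun e => e ▸ le_rfl)
    fun hl => (add_lt_add_left_of_connected hl b).le
  exact h1.trans h2

theorem lt_add_of_pos_of_connected {b : C} (hb : 0 < b) (x : C) : x < x + b := by
  simpa only [Gyrogroup.add_zero] using add_lt_add_left_of_connected hb x

theorem neg_lt_neg_of_connected {a b : C} (h : a < b) : -b < -a := by
  by_contra! hle
  have := add_le_add_of_connected hle (le_refl b)
  rw [Gyrogroup.neg_add_self] at this
  have h2 := add_lt_add_left_of_connected h (-a)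
  rw [Gyrogroup.neg_add_self] at h2
  exact this.not_gt h2

/-- Archimedean property of a connected ordered gyrogroup. -/
theorem exists_lt_iterate_add_right {b : C} (hb : 0 < b) (u : C) :
    ∃ k : ℕ, u < (fun x => x + b)^[k] 0 := by
  set x : ℕ → C := fun k => (fun x => x + b)^[k] 0 with hx
  have hsucc : ∀ k, x (k + 1) = x k + b := fun k => Function.iterate_succ_apply' _ _ _
  have hU : IsClopen {y : C | ∃ k, y < x k} := by
    constructor
    -- If `y` bounds all iterates, so does any nearby `z` with `y < z + b`: from `z < x k` would
    -- follow `y < x (k + 1)`.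
    · rw [← isOpen_compl_iff, isOpen_iff_mem_nhds]
      intro y hy
      have hopen : IsOpen {z : C | y < z + b} := isOpen_lt continuous_const (by fun_prop)
      filter_upwards [hopen.mem_nhds (lt_add_of_pos_of_connected hb y)] with z hz
      rintro ⟨k, hk⟩
      exact hy ⟨k + 1, hsucc k ▸ lt_trans hz (add_lt_add_right_of_connected hk b)⟩
    · simp only [ofPred_exists]
      exact isOpen_iUnion fun k => isOpen_Iio
  have := hU.eq_univ ⟨0, 1, by simpa [hx, Gyrogroup.zero_add] using hb⟩
  exact (this.symm ▸ mem_univ u : u ∈ {y : C | ∃ k, y < x k})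

/-- If some `y0 > 0` were a lower bound of `b`, the set of lower bounds would be clopen: with `y >
0` it contains `y + y`, hence a neighbourhood of `y`. Then `b 0` would be a lower bound, against `b
1 < b 0`. -/
theorem tendsto_zero_of_add_self_le {b : ℕ → C} (hpos : ∀ n, 0 < b n)
    (hb : ∀ n, b (n + 1) + b (n + 1) ≤ b n) : Tendsto b atTop (𝓝 0) := by
  have hlt : ∀ n, b (n + 1) < b n := fun n =>
    (lt_add_of_pos_of_connected (hpos _) _).trans_le (hb n)
  have hanti : StrictAnti b := strictAnti_nat_of_succ_lt hlt
  have key : ∀ y, 0 < y → ∃ n, b n < y := by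
    intro y0 hy0
    by_contra! hle
    have hU : IsClopen {y : C | ∀ n, y ≤ b n} := by
      constructor
      · simp only [ofPred_forall]
        exact isClosed_iInter fun n => isClosed_Iic
      · rw [isOpen_iff_mem_nhds]
        intro y hy
        rcases le_or_gt y 0 with h0 | h0
        · filter_upwards [Iio_mem_nhds (h0.trans_lt hy0)] with z hz n
          exact hz.le.trans (hle n)
        · filter_upwards [Iio_mem_nhds (lt_add_of_pos_of_connected h0 y)] with z hz n
          exact hz.le.trans ((add_le_add_of_connected (hy _) (hy _)).trans (hb n))
    have := hU.eq_univ ⟨y0, hle⟩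
    have h1 : b 0 ∈ {y : C | ∀ n, y ≤ b n} := this.symm ▸ mem_univ _
    exact (hlt 0).not_ge (h1 1)
  refine tendsto_order.2 ⟨fun a ha => Eventually.of_forall fun n => ha.trans (hpos n), ?_⟩
  intro a ha
  obtain ⟨n, hn⟩ := key a ha
  filter_upwards [eventually_ge_atTop n] with m hm
  exact (hanti.antitone hm).trans_lt hn

/-- Walk from `0` in steps `b n` so small that `u + b n < v`: the first iterate beyond `u` has not
yet reached `v`. -/
theorem exists_mem_Ioo_of_tendsto_zero {b : ℕ → C} (hpos : ∀ n, 0 < b n)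
    (hb : Tendsto b atTop (𝓝 0)) {K : Set C} (hK : IsSubgyrogroup K) (hbK : ∀ n, b n ∈ K)
    {u v : C} (hu : 0 ≤ u) (huv : u < v) : ∃ x ∈ K, x ∈ Ioo u v := by
  have h1 : Tendsto (fun n => u + b n) atTop (𝓝 u) := by
    simpa only [Gyrogroup.add_zero] using (tendsto_const_nhds (x := u)).add hb
  obtain ⟨n, hn⟩ := (h1.eventually (Iio_mem_nhds huv)).exists
  have hex := exists_lt_iterate_add_right (hpos n) u
  classical
  have hmem : ∀ k, (fun x => x + b n)^[k] 0 ∈ K := by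
    intro k
    induction k with
    | zero => exact hK.zero_mem
    | succ k ih =>
      rw [Function.iterate_succ_apply']
      exact hK.2.2 _ ih _ (hbK n)
  refine ⟨_, hmem (Nat.find hex), Nat.find_spec hex, ?_⟩
  obtain ⟨k, hk⟩ : ∃ k, Nat.find hex = k + 1 := by
    refine Nat.exists_eq_succ_of_ne_zero fun h0 => ?_
    have := Nat.find_spec hex
    rw [h0] at this
    exact hu.not_gt this
  have hle := Nat.find_min hex (m := k) (by omega)
  rw [hk, Function.iterate_succ_apply']
  exact (add_le_add_of_connected (not_lt.1 hle) le_rfl).trans_lt hn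

/-- Quantifying over all `K` allows an application to the trace on a component of a subgyrogroup of
a larger gyrogroup. -/
theorem exists_seq_tendsto_zero_generating_dense [Nontrivial C] :
    ∃ b : ℕ → C, Tendsto b atTop (𝓝 0) ∧ (∀ n, b n ≠ 0) ∧
      ∀ K : Set C, IsSubgyrogroup K → (∀ n, b n ∈ K) → Dense K := by
  have hneg0 : -(0 : C) = 0 := (neg_unique 0 0 (Gyrogroup.zero_add 0)).symm
  have hdense : DenselyOrdered C := by
    refine ⟨fun a b hab => ?_⟩
    obtain ⟨c, -, hc⟩ := (isPreconnected_univ (α := C)) (Ioi a) (Iio b) isOpen_Ioi isOpen_Iio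
      (fun x _ => (le_or_gt x a).elim (fun h => Or.inr (h.trans_lt hab)) Or.inl)
      ⟨b, trivial, hab⟩ ⟨a, trivial, hab⟩
    exact ⟨c, hc⟩
  obtain ⟨p, hp⟩ : ∃ p : C, 0 < p := by
    obtain ⟨x, hx⟩ := exists_ne (0 : C)
    rcases hx.lt_or_gt with h | h
    · exact ⟨-x, hneg0 ▸ neg_lt_neg_of_connected h⟩
    · exact ⟨x, h⟩
  have hhalf : ∀ a : {a : C // 0 < a}, ∃ c : {c : C // 0 < c}, c.1 + c.1 ≤ a.1 := by
    rintro ⟨a, ha⟩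
    have hcont : Tendsto (fun x : C => x + x) (𝓝 0) (𝓝 0) := by
      simpa only [Gyrogroup.add_zero] using
        (show Continuous fun x : C => x + x by fun_prop).tendsto 0
    have hev : ∀ᶠ x in 𝓝[>] (0 : C), x + x < a :=
      (hcont.eventually (Iio_mem_nhds ha)).filter_mono nhdsWithin_le_nhds
    have : (𝓝[>] (0 : C)).NeBot := nhdsGT_neBot_of_exists_gt ⟨a, ha⟩
    obtain ⟨c, hc, hc0⟩ := (hev.and self_mem_nhdsWithin).exists
    exact ⟨⟨c, hc0⟩, hc.le⟩
  choose half hhalf using hhalf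
  set b : ℕ → {a : C // 0 < a} := fun n => half^[n] ⟨p, hp⟩
  have hb : Tendsto (fun n => (b n).1) atTop (𝓝 0) := by
    refine tendsto_zero_of_add_self_le (fun n => (b n).2) fun n => ?_
    have : b (n + 1) = half (b n) := Function.iterate_succ_apply' _ _ _
    rw [this]
    exact hhalf _
  refine ⟨_, hb, fun n => (b n).2.ne', fun K hK hbK => ?_⟩
  refine dense_of_exists_between fun u v huv => ?_
  have hpos := fun {u v : C} => exists_mem_Ioo_of_tendsto_zero (u := u) (v := v)
    (fun n => (b n).2) hb hK hbK
  rcases le_or_gt 0 u with h0 | h0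
  · obtain ⟨x, hxK, hx⟩ := hpos h0 huv
    exact ⟨x, hxK, hx⟩
  -- For `u < 0`, cut the interval at `0` and reflect it by inversion into the nonnegative side.
  · have hmin : 0 ≤ -min 0 v := by
      rcases (min_le_left 0 v).eq_or_lt with h | h
      · rw [h, hneg0]
      · exact (hneg0 ▸ neg_lt_neg_of_connected h).le
    obtain ⟨x, hxK, hx⟩ := hpos hmin (neg_lt_neg_of_connected (lt_min h0 huv))
    refine ⟨-x, hK.2.1 x hxK, ?_, ?_⟩
    · have := neg_lt_neg_of_connected hx.2
      rwa [neg_neg_gyro] at this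
    · have := neg_lt_neg_of_connected hx.1
      rw [neg_neg_gyro] at this
      exact this.trans_le (min_le_right _ _)

end ConnectedOrder

/-! ### Components under left translation. -/

section Component

variable {G : Type*} [TopologicalSpace G] [Gyrogroup G]

theorem add_mem_connectedComponent_iff [ContinuousAdd G] (g x : G) :
    g + x ∈ connectedComponent g ↔ x ∈ connectedComponent (0 : G) := by
  constructor
  · intro h
    have := (show Continuous fun y : G => -g + y by fun_prop).image_connectedComponent_subset g
      (mem_image_of_mem _ h)
    rwa [neg_add_cancel_left_gyro, Gyrogroup.neg_add_self] at this
  · intro h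
    have := (show Continuous fun y : G => g + y by fun_prop).image_connectedComponent_subset 0
      (mem_image_of_mem _ h)
    rwa [Gyrogroup.add_zero] at this

theorem isSubgyrogroup_connectedComponent_zero [TopologicalGyrogroup G] :
    IsSubgyrogroup (connectedComponent (0 : G)) := by
  refine ⟨⟨0, mem_connectedComponent⟩, fun a ha => ?_, fun a ha b hb => ?_⟩
  · have := (continuous_neg (G := G)).image_connectedComponent_subset 0 (mem_image_of_mem _ ha)
    rwa [← neg_unique (0 : G) 0 (Gyrogroup.zero_add 0)] at this
  · rw [connectedComponent_eq ha]
    exact (add_mem_connectedComponent_iff a b).2 hb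

/-- Left translations permute components, so an interior point of one component can be moved to `0`
and then to any `y`. -/
theorem isOpen_connectedComponent_of_mem_nhds [ContinuousAdd G] {m : G}
    (hm : connectedComponent m ∈ 𝓝 m) (x : G) : IsOpen (connectedComponent x) := by
  have h0 : connectedComponent (0 : G) ∈ 𝓝 (0 : G) := by
    have hc : Tendsto (fun y : G => m + y) (𝓝 0) (𝓝 m) := by
      simpa only [Gyrogroup.add_zero] using
        (show Continuous fun y : G => m + y by fun_prop).tendsto 0
    filter_upwards [hc hm] with y hy
    exact (add_mem_connectedComponent_iff m y).1 hy
  rw [isOpen_iff_mem_nhds]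
  intro y hy
  rw [connectedComponent_eq hy]
  have hc : Tendsto (fun z : G => -y + z) (𝓝 y) (𝓝 0) := by
    simpa only [Gyrogroup.neg_add_self] using
      (show Continuous fun z : G => -y + z by fun_prop).tendsto y
  filter_upwards [hc h0] with z hz
  have := (add_mem_connectedComponent_iff y (-y + z)).2 hz
  rwa [add_neg_cancel_left_gyro] at this

end Component

end Gyrogroup

/-! ### Topological lemmas: interior of a component, sets with one possible accumulation point. -/

/-- Components are order convex, and `Ioo x y` is nonempty since otherwise two rays would separate
the component. -/
theorem exists_connectedComponent_mem_nhds {X : Type*} [TopologicalSpace X] [LinearOrder X] [OrderTopology X]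
    {x y : X} (hy : y ∈ connectedComponent x) (hxy : x < y) :
    ∃ m : X, connectedComponent m ∈ 𝓝 m := by
  have hC : IsPreconnected (connectedComponent x) := isPreconnected_connectedComponent
  obtain ⟨m, -, hm⟩ := hC (Ioi x) (Iio y) isOpen_Ioi isOpen_Iio
    (fun z _ => (le_or_gt z x).elim (fun h => Or.inr (h.trans_lt hxy)) Or.inl)
    ⟨y, hy, hxy⟩ ⟨x, mem_connectedComponent, hxy⟩
  have hsub : Ioo x y ⊆ connectedComponent x :=
    Ioo_subset_Icc_self.trans (hC.ordConnected.out mem_connectedComponent hy)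
  refine ⟨m, ?_⟩
  rw [← connectedComponent_eq (hsub hm)]
  exact mem_of_superset (isOpen_Ioo.mem_nhds hm) hsub

/-- Removing finitely many points from a neighbourhood shows that `S` accumulates at most at `a`. -/
theorem isDiscrete_and_isClosed_union_singleton_of_finite {X : Type*} [TopologicalSpace X]
    [T1Space X] {S : Set X} {a : X} (ha : a ∉ S) (h : ∀ x ≠ a, ∃ U ∈ 𝓝 x, (U ∩ S).Finite) :
    IsDiscrete S ∧ IsClosed (S ∪ {a}) := by
  have key : ∀ x ≠ a, ∀ᶠ y in 𝓝 x, y ∈ S → y = x := by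
    intro x hx
    obtain ⟨U, hU, hfin⟩ := h x hx
    have hc : ((U ∩ S) \ {x})ᶜ ∈ 𝓝 x :=
      hfin.sdiff.isClosed.isOpen_compl.mem_nhds (by simp)
    filter_upwards [hU, hc] with y hyU hy hyS
    by_contra hne
    exact hy ⟨⟨hyU, hyS⟩, hne⟩
  constructor
  · rw [isDiscrete_iff_forall_mem_exists_isOpen]
    intro x hx
    obtain ⟨V, hV, hVo, hxV⟩ := eventually_nhds_iff.1 (key x (ne_of_mem_of_not_mem hx ha))
    exact ⟨V, hVo, by ext y; exact ⟨fun hy => hV y hy.1 hy.2, fun hy => hy ▸ ⟨hxV, hx⟩⟩⟩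
  · rw [← isOpen_compl_iff, isOpen_iff_mem_nhds]
    intro x hx
    have hxa : x ≠ a := fun e => hx (Or.inr e)
    filter_upwards [key x hxa, isOpen_ne.mem_nhds hxa] with y hy hya
    rintro (hyS | hya')
    · exact hx (Or.inl (hy hyS ▸ hyS))
    · exact hya hya'

namespace Gyrogroup

/-! ### Assembly of the suitable set. -/

theorem exists_isSuitableSet_of_isOpen_connectedComponent {G : Type*} [TopologicalSpace G]
    [Gyrogroup G] [ContinuousAdd G] [T2Space G] (hopen : ∀ x : G, IsOpen (connectedComponent x))
    {b : ℕ → G} (hb : Tendsto b atTop (𝓝 0)) (hb0 : ∀ n, b n ≠ 0)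
    (hbC : ∀ n, b n ∈ connectedComponent (0 : G))
    (hdense : ∀ K : Set G, IsSubgyrogroup K → (∀ n, b n ∈ K) →
      connectedComponent (0 : G) ⊆ closure K) :
    ∃ S : Set G, IsSuitableSet S := by
  -- `r` picks one representative per component; `D` omits that of the identity component, where `b`
  -- already generates.
  set r : G → G := fun x => Quotient.out (ConnectedComponents.mk x : ConnectedComponents G)
  have hr : ∀ x, connectedComponent (r x) = connectedComponent x := fun x =>
    ConnectedComponents.coe_eq_coe.1 (Quotient.out_eq (ConnectedComponents.mk x))
  have hr' : ∀ x y, connectedComponent x = connectedComponent y → r x = r y := fun x y h =>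
    congrArg Quotient.out (ConnectedComponents.coe_eq_coe.2 h)
  have hself : ∀ x : G, x ∈ connectedComponent x := fun x => mem_connectedComponent
  set D : Set G := range r \ connectedComponent 0
  have h0 : (0 : G) ∉ range b ∪ D := by
    rintro (⟨n, hn⟩ | h)
    · exact hb0 n hn
    · exact h.2 (hself 0)
  have hfin : ∀ x ≠ (0 : G), ∃ U ∈ 𝓝 x, (U ∩ (range b ∪ D)).Finite := by
    intro x hx
    -- Inside the identity component, a neighbourhood separated from `0` misses a tail of `b`; any
    -- other component meets the set at most in its representative.
    by_cases hxC : x ∈ connectedComponent (0 : G)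
    · obtain ⟨U, V, hU, hV, hxU, h0V, hUV⟩ := t2_separation hx
      obtain ⟨N, hN⟩ := eventually_atTop.1 (hb (hV.mem_nhds h0V))
      refine ⟨U ∩ connectedComponent 0,
        inter_mem (hU.mem_nhds hxU) ((hopen 0).mem_nhds hxC), ?_⟩
      refine ((finite_Iio N).image b).subset ?_
      rintro _ ⟨⟨hyU, hyC⟩, ⟨n, rfl⟩ | hyD⟩
      · refine ⟨n, ?_, rfl⟩
        by_contra hn
        exact disjoint_left.1 hUV hyU (hN n (not_lt.1 hn))
      · exact absurd hyC hyD.2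
    · refine ⟨_, (hopen x).mem_nhds (hself x), (finite_singleton (r x)).subset ?_⟩
      rintro _ ⟨hy, ⟨n, rfl⟩ | ⟨⟨z, rfl⟩, -⟩⟩
      · refine absurd ?_ hxC
        rw [connectedComponent_eq (hbC n), ← connectedComponent_eq hy]
        exact hself x
      · exact hr' _ _ ((hr z).symm.trans (connectedComponent_eq hy).symm)
  obtain ⟨h1, h2⟩ := isDiscrete_and_isClosed_union_singleton_of_finite h0 hfin
  refine ⟨range b ∪ D, h1, h2, fun x => ?_⟩
  have hK := isSubgyrogroup_generated (range b ∪ D)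
  have hCK := hdense _ hK fun n => subset_generated _ (Or.inl ⟨n, rfl⟩)
  by_cases hxC : x ∈ connectedComponent (0 : G)
  · exact hCK hxC
  -- Write `x = r x + (-r x + x)` with the second term in the identity component, and translate the
  -- approximation there.
  · have hrK : r x ∈ generated (range b ∪ D) := by
      refine subset_generated _ (Or.inr ⟨⟨x, rfl⟩, fun h => hxC ?_⟩)
      rw [connectedComponent_eq h, hr]
      exact hself x
    have hmem : -r x + x ∈ connectedComponent (0 : G) := by
      rw [← add_mem_connectedComponent_iff (r x), add_neg_cancel_left_gyro, hr]
      exact hself x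
    rw [← add_neg_cancel_left_gyro (r x) x]
    exact map_mem_closure (f := fun y => r x + y) (by fun_prop) (hCK hmem)
      fun y hy => hK.2.2 _ hrK y hy

end Gyrogroup

open Gyrogroup in
theorem corollary4p5 (G : Type*) [TopologicalSpace G] [Gyrogroup G]
    [StronglyTopologicalGyrogroup G] (hord : TopologicallyOrderable G)
    (hdisc : ¬ TotallyDisconnectedSpace G) :
    ∃ S : Set G, IsSuitableSet S := by
  obtain ⟨_, _⟩ := hord
  obtain ⟨x, y, hy, hyx⟩ : ∃ x y : G, y ∈ connectedComponent x ∧ y ≠ x := by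
    by_contra! h
    exact hdisc (totallyDisconnectedSpace_iff_connectedComponent_singleton.2 fun x =>
      eq_singleton_iff_unique_mem.2 ⟨mem_connectedComponent, h x⟩)
  obtain ⟨m, hm⟩ : ∃ m : G, connectedComponent m ∈ 𝓝 m := by
    rcases hyx.lt_or_gt with h | h
    · exact exists_connectedComponent_mem_nhds (connectedComponent_eq hy ▸ mem_connectedComponent) h
    · exact exists_connectedComponent_mem_nhds hy h
  have hH := isSubgyrogroup_connectedComponent_zero (G := G)
  let := hH.toGyrogroup
  have hpre : IsPreconnected (connectedComponent (0 : G)) := isPreconnected_connectedComponent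
  have : OrdConnected (connectedComponent (0 : G)) := hpre.ordConnected
  have : PreconnectedSpace (connectedComponent (0 : G)) := Subtype.preconnectedSpace hpre
  have : ContinuousAdd (connectedComponent (0 : G)) :=
    ⟨Continuous.subtype_mk (by fun_prop) _⟩
  have : Nontrivial (connectedComponent (0 : G)) := by
    refine ⟨⟨⟨-x + y, ?_⟩, 0, fun h => hyx ?_⟩⟩
    · rwa [← add_mem_connectedComponent_iff x, add_neg_cancel_left_gyro]
    · have h' : -x + y = 0 := congrArg Subtype.val h
      rw [← add_neg_cancel_left_gyro x y, h', Gyrogroup.add_zero]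
  obtain ⟨b, hb, hb0, hdense⟩ :=
    exists_seq_tendsto_zero_generating_dense (C := connectedComponent (0 : G))
  refine exists_isSuitableSet_of_isOpen_connectedComponent
    (isOpen_connectedComponent_of_mem_nhds hm) (b := fun n => (b n).1)
    ((continuous_subtype_val.tendsto _).comp hb) (fun n h => hb0 n (Subtype.ext h))
    (fun n => (b n).2) fun K hK hbK c hc => ?_
  -- The trace of `K` on the component is a subgyrogroup containing `b`, hence dense there.
  have hK' : Dense {a : connectedComponent (0 : G) | a.1 ∈ K} :=
    hdense _ ⟨⟨0, hK.zero_mem⟩, fun a ha => hK.2.1 a.1 ha,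
      fun a ha a' ha' => hK.2.2 a.1 ha a'.1 ha'⟩ hbK
  exact map_mem_closure continuous_subtype_val (hK' ⟨c, hc⟩) fun a ha => ha
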